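/- Let $V$ be a smooth affine variety over $\mathbb{C}$, let $X\subseteq V$ be a closed subvariety with (radical) ideal $\mathcal{I}_X\subseteq \mathcal{O}_V$, and let $D_V$ be the ring of differential operators on $V$. Let $\mathcal{A}$ be the category of right $D_V$-modules supported on $X$ (that is, whose support as $\mathcal{O}_V$-modules is contained in $X$), and let $D^b_{\mathcal{A}}(D_V)$ be the full subcategory of the derived category of right $D_V$-modules consisting of the bounded complexes all of whose cohomology modules are supported on $X$. Then the right $D_V$-module $D_X=\mathcal{I}_XD_V\backslash D_V$, placed in degree $0$, is an object of $D^b_{\mathcal{A}}(D_V)$ and is a compact generator of it, i.e. - (compactness) the functor $\operatorname{Hom}(D_X,-)$ on $D^b_{\mathcal{A}}(D_V)$, with values in abelian groups, commutes with all (small) direct sums that exist in $D^b_{\mathcal{A}}(D_V)$; - (generation) if $C\in D^b_{\mathcal{A}}(D_V)$ satisfies $\operatorname{Hom}(D_X[i],C)=0$ for all $i\in\mathbb{Z}$, then $C=0$. -/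

import Mathlib

universe w u

open CategoryTheory CategoryTheory.Limits Opposite

/-! ### Grothendieck differential operators on an affine scheme -/

/-- The `k`-linear differential operators `P : A → A` of order `< n`: only `0` has order `< 0`,
and `P` has order `< n + 1` iff the commutator `[P, a]` has order `< n` for every function `a`. -/
def diffOpLT (k A : Type*) [CommRing k] [CommRing A] [Algebra k A] :
    ℕ → Submodule k (Module.End k A)
  | 0 => ⊥
  | n + 1 =>
    { carrier := {P | ∀ a : A,
        P * Algebra.lmul k A a - Algebra.lmul k A a * P ∈ diffOpLT k A n}
      zero_mem' := fun a => by simp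
      add_mem' := fun {P Q} hP hQ a => by
        have h := add_mem (hP a) (hQ a)
        convert h using 1
        noncomm_ring
      smul_mem' := fun c P hP a => by
        have h := Submodule.smul_mem _ c (hP a)
        convert h using 1
        rw [smul_sub, smul_mul_assoc, mul_smul_comm] }

theorem mem_diffOpLT_succ {k A : Type*} [CommRing k] [CommRing A] [Algebra k A] {n : ℕ}
    {P : Module.End k A} : P ∈ diffOpLT k A (n + 1) ↔
      ∀ a : A, P * Algebra.lmul k A a - Algebra.lmul k A a * P ∈ diffOpLT k A n :=
  Iff.rfl

theorem diffOpLT_le_succ (k A : Type*) [CommRing k] [CommRing A] [Algebra k A] (n : ℕ) :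
    diffOpLT k A n ≤ diffOpLT k A (n + 1) := by
  induction n with
  | zero => exact bot_le
  | succ n ih => exact fun P hP => mem_diffOpLT_succ.2 fun a => ih (hP a)

theorem diffOpLT_mono (k A : Type*) [CommRing k] [CommRing A] [Algebra k A] :
    Monotone (diffOpLT k A) :=
  monotone_nat_of_le_succ (diffOpLT_le_succ k A)

theorem lmul_mem_diffOpLT (k : Type*) {A : Type*} [CommRing k] [CommRing A] [Algebra k A]
    (a : A) : Algebra.lmul k A a ∈ diffOpLT k A 1 := by
  refine mem_diffOpLT_succ.2 fun b => ?_
  rw [← map_mul, ← map_mul, mul_comm, sub_self]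
  exact zero_mem _

theorem mul_mem_diffOpLT {k A : Type*} [CommRing k] [CommRing A] [Algebra k A] :
    ∀ (m n : ℕ) {P Q : Module.End k A}, P ∈ diffOpLT k A m → Q ∈ diffOpLT k A n →
      P * Q ∈ diffOpLT k A (m + n)
  | 0, n, P, Q, hP, _ => by
    rw [(Submodule.mem_bot k).1 hP, zero_mul]
    exact zero_mem _
  | m + 1, 0, P, Q, _, hQ => by
    rw [(Submodule.mem_bot k).1 hQ, mul_zero]
    exact zero_mem _
  | m + 1, n + 1, P, Q, hP, hQ => by
    refine mem_diffOpLT_succ.2 fun a => ?_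
    have h₁ := mul_mem_diffOpLT (m + 1) n hP (hQ a)
    have h₂ := mul_mem_diffOpLT m (n + 1) (hP a) hQ
    rw [show m + (n + 1) = m + 1 + n by omega] at h₂
    have h := add_mem h₁ h₂
    have e : P * Q * Algebra.lmul k A a - Algebra.lmul k A a * (P * Q) =
        P * (Q * Algebra.lmul k A a - Algebra.lmul k A a * Q) +
          (P * Algebra.lmul k A a - Algebra.lmul k A a * P) * Q := by
      rw [mul_sub, sub_mul]
      simp only [mul_assoc]
      abel
    rw [← e] at h
    exact h

/-- The ring `D_V` of differential operators on `V = Spec A` over `k`: the `k`-linear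
endomorphisms of `A` that are differential operators of some finite order. -/
def diffOp (k A : Type*) [CommRing k] [CommRing A] [Algebra k A] :
    Subalgebra k (Module.End k A) where
  carrier := {P | ∃ n : ℕ, P ∈ diffOpLT k A n}
  mul_mem' := by
    rintro P Q ⟨m, hP⟩ ⟨n, hQ⟩
    exact ⟨m + n, mul_mem_diffOpLT m n hP hQ⟩
  add_mem' := by
    rintro P Q ⟨m, hP⟩ ⟨n, hQ⟩
    exact ⟨m + n, add_mem (diffOpLT_mono k A (Nat.le_add_right m n) hP)
      (diffOpLT_mono k A (Nat.le_add_left n m) hQ)⟩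
  algebraMap_mem' c := ⟨1, by
    rw [← AlgHom.commutes (Algebra.lmul k A) c]
    exact lmul_mem_diffOpLT k _⟩

/-- The inclusion `O_V ⊆ D_V` of functions as differential operators of order zero. -/
def diffOpOfFun (k A : Type*) [CommRing k] [CommRing A] [Algebra k A] : A →ₐ[k] diffOp k A :=
  (Algebra.lmul k A).codRestrict (diffOp k A) fun a => ⟨1, lmul_mem_diffOpLT k a⟩

/-! ### Right `D_V`-modules and their supports

Right `D_V`-modules are (left) modules over the opposite ring of `D_V`. -/

/-- The inclusion of the commutative ring `O_V` in the opposite ring of `D_V`; restricting scalars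
along it turns a right `D_V`-module into an `O_V`-module. -/
def diffOpOfFunOp (k A : Type*) [CommRing k] [CommRing A] [Algebra k A] :
    A →+* (diffOp k A)ᵐᵒᵖ :=
  (diffOpOfFun k A : A →+* diffOp k A).toOpposite fun a b => by
    simp only [commute_iff_eq, RingHom.coe_coe, ← map_mul, mul_comm]

/-- A right `D_V`-module `M` is supported on the closed subset `X = V(I)` of `V = Spec A`: the
support of the `O_V`-module underlying `M` is contained in `X`. -/
def IsSupportedOn {k : Type*} {A : Type u} [CommRing k] [CommRing A] [Algebra k A] (I : Ideal A)
    (M : ModuleCat.{u} (diffOp k A)ᵐᵒᵖ) : Prop :=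
  Module.support A ((ModuleCat.restrictScalars (diffOpOfFunOp k A)).obj M) ⊆
    PrimeSpectrum.zeroLocus (I : Set A)

theorem IsSupportedOn.of_iso {k : Type*} {A : Type u} [CommRing k] [CommRing A] [Algebra k A]
    {I : Ideal A} {M N : ModuleCat.{u} (diffOp k A)ᵐᵒᵖ}
    (e : M ≅ N)
    (h : IsSupportedOn I M) : IsSupportedOn I N := by
  have e' := ((ModuleCat.restrictScalars (diffOpOfFunOp k A)).mapIso e).toLinearEquiv
  unfold IsSupportedOn
  rw [← e'.support_eq]
  exact h

/-- The right `R`-module `S R \ R`: the quotient of the ring `R` by the right ideal generated by the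
subset `S`. -/
abbrev rightQuotient (R : Type u) [Ring R] (S : Set R) : ModuleCat.{u} Rᵐᵒᵖ :=
  ModuleCat.of Rᵐᵒᵖ (R ⧸ Submodule.span Rᵐᵒᵖ S)

/-- The right `D_V`-module `D_X = I D_V \ D_V` attached to the closed subscheme `X = V(I)` of
`V = Spec A`: the quotient of `D_V` by the right ideal generated by `I`. -/
def canonicalDModule (k : Type*) {A : Type u} [CommRing k] [CommRing A] [Algebra k A]
    (I : Ideal A) : ModuleCat.{u} (diffOp k A)ᵐᵒᵖ :=
  rightQuotient (diffOp k A) (diffOpOfFun k A '' (I : Set A))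

/-! ### The bounded derived category with supports -/

section Derived

variable {k : Type*} {A : Type u} [CommRing k] [CommRing A] [Algebra k A]
  [HasDerivedCategory.{w} (ModuleCat.{u} (diffOp k A)ᵐᵒᵖ)]

/-- The objects of the derived category `D(D_V)` of right `D_V`-modules all of whose cohomology
modules are supported on `X = V(I)`. -/
def cohomologySupportedOn (I : Ideal A) :
    ObjectProperty (DerivedCategory (ModuleCat.{u} (diffOp k A)ᵐᵒᵖ)) := fun K =>
  ∀ n : ℤ, IsSupportedOn I ((DerivedCategory.homologyFunctor _ n).obj K)

/-- The objects of the derived category of right `D_V`-modules which are bounded and all of whose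
cohomology modules are supported on `X = V(I)`. -/
def boundedSupportedOn (I : Ideal A) :
    ObjectProperty (DerivedCategory (ModuleCat.{u} (diffOp k A)ᵐᵒᵖ)) :=
  DerivedCategory.TStructure.t.bounded ⊓ cohomologySupportedOn I

instance (I : Ideal A) :
    (cohomologySupportedOn (k := k) I).IsStableUnderShift ℤ where
  isStableUnderShiftBy a := ⟨fun K hK n => (hK (a + n)).of_iso
    (((DerivedCategory.homologyFunctor _ 0).shiftIso a n (a + n) rfl).symm.app K)⟩

instance (I : Ideal A) : (boundedSupportedOn (k := k) I).IsStableUnderShift ℤ := by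
  unfold boundedSupportedOn
  infer_instance

variable (k) in
/-- The category `D^b_A(D_V)`: the full subcategory of the derived category of right `D_V`-modules
whose objects are the bounded complexes with cohomology supported on `X = V(I)`. -/
abbrev BoundedDerivedSupportedOn (I : Ideal A) : Type _ :=
  (boundedSupportedOn (k := k) I).FullSubcategory

end Derived

/-! ### Compact objects and generators -/

/-- An object `E` is compact if `Hom(E, -)`, with values in abelian groups, commutes with all
(small) direct sums that exist in the category. -/
def IsCompactObject {T : Type*} [Category* T] [Preadditive T] (E : T) : Prop :=
  ∀ J : Type u, PreservesColimitsOfShape (Discrete J) (preadditiveCoyoneda.obj (op E))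

/-- An object `E` is a generator if an object `C` with `Hom(E[i], C) = 0` for all `i : ℤ`
is zero. -/
def IsGeneratorObject {T : Type*} [Category* T] [HasZeroMorphisms T] [HasShift T ℤ] (E : T) :
    Prop :=
  ∀ C : T, (∀ (i : ℤ) (f : (shiftFunctor T i).obj E ⟶ C), f = 0) → IsZero C

-- Write `D` for the ring of differential operators. If `P` has order `< n`, then `P * f ^ n` lies
-- in `I D` for `f ∈ I`, so `D_X` is supported on `X`.
--
-- Compactness rests on two facts. The first is that `D_X` has arbitrarily long partial resolutions
-- by finitely generated projectives (`hasFiniteProjectiveResolution_canonicalDModule`). In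
-- characteristic zero Euler's identity makes each step of the order filtration projective over `A`,
-- so `D` is flat over `A` (`flat_diffOp`). Hence `I D ≅ D ⊗ I`, and tensoring a resolution of `I`
-- over the noetherian ring `A` with `D` stays exact. No bound on the global dimension is needed:
-- into a complex in degrees `≥ a`, a sufficiently long partial resolution determines all morphisms,
-- by dimension shifting (`eventually_comp_eq`).
--
-- The second fact concerns coproducts. A coproduct `c` in the bounded category with supports is not
-- assumed to be one in the derived category. Its terms are retracts of `c`, hence uniformly
-- bounded, so the direct sum `S` of representing complexes lies in the same subcategory, and `c` is
-- a retract of `S`. Thus each homology class of `c` is fixed by the projections to all large enough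
-- finite subsums. Dimension shifting carries this to every morphism from `D_X`, which therefore
-- factors through a finite subsum (`exists_comp_cofanIdempotent_eq`).
--
-- For generation, the lowest cohomology module of a nonzero `C` contains a nonzero element killed
-- by `I`, because it is `I`-torsion and `A` is noetherian. This gives a nonzero map from `D_X` to
-- that module, which lifts to a nonzero map from a shift of `D_X` to `C`.

universe v

/-! ### Flatness of the ring of differential operators of a smooth algebra -/

section DiffOp

variable {k A : Type*} [CommRing k] [CommRing A] [Algebra k A]

theorem lmul_mul_eq_smul (a : A) (P : Module.End k A) : Algebra.lmul k A a * P = a • P :=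
  rfl

/-- The commutator `P ↦ [P, a]` with a function, as an `A`-linear map. -/
def commutatorLeft (k : Type*) {A : Type*} [CommRing k] [CommRing A] [Algebra k A] (a : A) :
    Module.End k A →ₗ[A] Module.End k A where
  toFun P := P * Algebra.lmul k A a - Algebra.lmul k A a * P
  map_add' P Q := by noncomm_ring
  map_smul' b P := by
    ext c
    simp
    ring

theorem commutatorLeft_apply (a : A) (P : Module.End k A) :
    commutatorLeft k a P = P * Algebra.lmul k A a - Algebra.lmul k A a * P :=
  rfl

theorem commutatorLeft_mem {n : ℕ} {P : Module.End k A} (hP : P ∈ diffOpLT k A (n + 1)) (a : A) :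
    commutatorLeft k a P ∈ diffOpLT k A n :=
  mem_diffOpLT_succ.1 hP a

theorem commutatorLeft_comm (a b : A) (P : Module.End k A) :
    commutatorLeft k a (commutatorLeft k b P) = commutatorLeft k b (commutatorLeft k a P) := by
  ext c
  simp only [commutatorLeft_apply, LinearMap.sub_apply, Module.End.mul_apply,
    Algebra.coe_lmul_eq_mul,
    LinearMap.mul_apply_apply, mul_left_comm a b, map_sub]
  ring

theorem commutatorLeft_mul (a : A) (P Q : Module.End k A) :
    commutatorLeft k a (P * Q) = commutatorLeft k a P * Q + P * commutatorLeft k a Q := by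
  simp only [commutatorLeft_apply, sub_mul, mul_sub, mul_assoc]
  abel

theorem commutatorLeft_derivation (a : A) (δ : Derivation k A A) :
    commutatorLeft k a (δ : A →ₗ[k] A) = Algebra.lmul k A (δ a) := by
  ext c
  simp [commutatorLeft_apply]
  ring

theorem smul_mem_diffOpLT (a : A) {n : ℕ} {P : Module.End k A} (hP : P ∈ diffOpLT k A n) :
    a • P ∈ diffOpLT k A n := by
  induction n generalizing P with
  | zero =>
    rw [(Submodule.mem_bot k).1 hP, smul_zero]
    exact zero_mem _
  | succ n ih =>
    refine mem_diffOpLT_succ.2 fun b => ?_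
    rw [← commutatorLeft_apply, map_smul]
    exact ih (commutatorLeft_mem hP b)

/-- The differential operators of order `< n`, as a left `A`-module. -/
def diffOpLTModule (k A : Type*) [CommRing k] [CommRing A] [Algebra k A] (n : ℕ) :
    Submodule A (Module.End k A) :=
  { diffOpLT k A n with smul_mem' := fun a _ hP => smul_mem_diffOpLT a hP }

theorem mem_diffOpLTModule {n : ℕ} {P : Module.End k A} :
    P ∈ diffOpLTModule k A n ↔ P ∈ diffOpLT k A n :=
  Iff.rfl

theorem mul_lmul_mem_diffOpLT {n : ℕ} {P : Module.End k A} (hP : P ∈ diffOpLT k A n) (a : A) :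
    P * Algebra.lmul k A a ∈ diffOpLT k A n := by
  cases n with
  | zero =>
    rw [(Submodule.mem_bot k).1 hP, zero_mul]
    exact zero_mem _
  | succ n =>
    have h := add_mem (diffOpLT_le_succ k A n (commutatorLeft_mem hP a)) (smul_mem_diffOpLT a hP)
    rwa [commutatorLeft_apply, lmul_mul_eq_smul, sub_add_cancel] at h

theorem mul_derivation_mem_diffOpLT (δ : Derivation k A A) {n : ℕ} {P : Module.End k A}
    (hP : P ∈ diffOpLT k A n) :
    P * (δ : A →ₗ[k] A) ∈ diffOpLT k A (n + 1) := by
  induction n generalizing P with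
  | zero =>
    rw [(Submodule.mem_bot k).1 hP, zero_mul]
    exact zero_mem _
  | succ n ih =>
    refine mem_diffOpLT_succ.2 fun a => ?_
    rw [← commutatorLeft_apply, commutatorLeft_mul, commutatorLeft_derivation]
    exact add_mem (ih (commutatorLeft_mem hP a)) (mul_lmul_mem_diffOpLT hP _)

/-- Modulo operators of order two less, the commutators `[P, a]` depend on `a` as a derivation. -/
def symbolDerivation {n : ℕ} {P : Module.End k A} (hP : P ∈ diffOpLT k A (n + 2)) :
    Derivation k A (Module.End k A ⧸ diffOpLTModule k A n) :=
  .mk' ({ toFun := fun a => (diffOpLTModule k A n).mkQ (commutatorLeft k a P)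
          map_add' := fun a b => by
            rw [← map_add]
            congr 1
            simp only [commutatorLeft_apply, map_add]
            noncomm_ring
          map_smul' := fun c a => by
            have : commutatorLeft k (c • a) P = c • commutatorLeft k a P := by
              simp [commutatorLeft_apply, smul_sub]
            rw [this]
            rfl } : A →ₗ[k] _) fun a b => by
    simp only [LinearMap.coe_mk, AddHom.coe_mk]
    rw [← (diffOpLTModule k A n).mkQ.map_smul, ← (diffOpLTModule k A n).mkQ.map_smul, ← map_add,
      ← sub_eq_zero, ← map_sub, Submodule.mkQ_apply,
      Submodule.Quotient.mk_eq_zero]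
    have h := commutatorLeft_mem (commutatorLeft_mem hP a) b
    rw [← mem_diffOpLTModule] at h
    convert h using 1
    ext c
    simp [commutatorLeft_apply, mul_assoc, mul_left_comm a b]
    ring

theorem symbolDerivation_apply {n : ℕ} {P : Module.End k A} (hP : P ∈ diffOpLT k A (n + 2))
    (a : A) : symbolDerivation hP a = (diffOpLTModule k A n).mkQ (commutatorLeft k a P) :=
  rfl

/-- A finite family of functions `x i` and derivations `δ i` with `da = ∑ δ i (a) dx i`. -/
structure IsDualFamily {ι : Type*} [Fintype ι] (x : ι → A) (δ : ι → Derivation k A A) : Prop where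
  eq_sum (a : A) : KaehlerDifferential.D k A a = ∑ i, δ i a • KaehlerDifferential.D k A (x i)

/-- The universal property of the Kähler differentials carries the defining identity to any
derivation; Euler's identity uses it for `symbolDerivation`. -/
theorem IsDualFamily.derivation_apply {ι : Type*} [Fintype ι] {x : ι → A}
    {δ : ι → Derivation k A A} (h : IsDualFamily x δ) {M : Type*} [AddCommGroup M] [Module A M]
    [Module k M] [IsScalarTower k A M] (D : Derivation k A M) (a : A) :
    D a = ∑ i, δ i a • D (x i) := by
  have := congr_arg D.liftKaehlerDifferential (h.eq_sum a)
  simpa using this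

/-- Smoothness makes the Kähler differentials finite projective. Finitely many `dx` generate them,
and the coordinates of a splitting of the resulting surjection from a free module are the
derivations. -/
theorem exists_isDualFamily (k A : Type*) [CommRing k] [CommRing A] [Algebra k A]
    [Algebra.Smooth k A] :
    ∃ (s : Finset A) (δ : s → Derivation k A A), IsDualFamily (fun i : s => (i : A)) δ := by
  classical
  have hfg : (Submodule.span A (Set.range (KaehlerDifferential.D k A))).FG := by
    rw [KaehlerDifferential.span_range_derivation]
    exact Module.finite_def.1 inferInstance
  obtain ⟨t, ht, hts⟩ := (Submodule.fg_span_iff_fg_span_finset_subset _).1 hfg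
  obtain ⟨s, -, rfl⟩ := Finset.subset_set_image_iff.1
    (show (t : Set _) ⊆ KaehlerDifferential.D k A '' Set.univ by rwa [Set.image_univ])
  rw [KaehlerDifferential.span_range_derivation] at hts
  let v : s → Ω[A⁄k] := fun i => KaehlerDifferential.D k A i
  have hv : Submodule.span A (Set.range v) = ⊤ := by
    rw [hts]
    congr 1
    ext y
    simp [v]
  have hsurj : Function.Surjective (Fintype.linearCombination A v) := by
    rw [← LinearMap.range_eq_top, Fintype.range_linearCombination, hv]
  obtain ⟨f, hf⟩ := Module.projective_lifting_property (Fintype.linearCombination A v)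
    LinearMap.id hsurj
  refine ⟨s, fun i => ((LinearMap.proj i).comp f).compDer (KaehlerDifferential.D k A),
    ⟨fun a => ?_⟩⟩
  have := LinearMap.congr_fun hf (KaehlerDifferential.D k A a)
  rw [LinearMap.comp_apply, Fintype.linearCombination_apply] at this
  exact this.symm

/-- Euler's identity for differential operators. -/
theorem IsDualFamily.euler_mem {ι : Type*} [Fintype ι] {x : ι → A}
    {δ : ι → Derivation k A A} (h : IsDualFamily x δ) (n : ℕ) {P : Module.End k A}
    (hP : P ∈ diffOpLT k A (n + 1)) :
    (n : k) • P - ∑ i, commutatorLeft k (x i) P * (δ i : A →ₗ[k] A) ∈ diffOpLT k A n := by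
  induction n generalizing P with
  | zero =>
    have : ∀ i, commutatorLeft k (x i) P = 0 := fun i =>
      (Submodule.mem_bot k).1 (commutatorLeft_mem hP _)
    simp [this]
  | succ n ih =>
    refine mem_diffOpLT_succ.2 fun a => ?_
    have h₁ := ih (commutatorLeft_mem hP a)
    -- This is the dual family identity for the symbol of `P`, lifted from the quotient.
    have h₂ : commutatorLeft k a P - ∑ i, δ i a • commutatorLeft k (x i) P ∈ diffOpLT k A n := by
      have := h.derivation_apply (symbolDerivation hP) a
      simp only [symbolDerivation_apply] at this
      simp_rw [← map_smul] at this
      rw [← map_sum, ← sub_eq_zero, ← map_sub, Submodule.mkQ_apply,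
        Submodule.Quotient.mk_eq_zero] at this
      simp only [map_smul] at this
      exact this
    -- These double commutators are the cost of moving `δ i a` to the left of `[P, x i]`.
    have h₃ : ∑ i, commutatorLeft k (δ i a) (commutatorLeft k (x i) P) ∈ diffOpLT k A n :=
      sum_mem fun i _ => commutatorLeft_mem (commutatorLeft_mem hP _) _
    have h₄ := sub_mem (add_mem h₁ h₂) h₃
    rw [← commutatorLeft_apply]
    convert h₄ using 1
    have hk : commutatorLeft k a (((n + 1 : ℕ) : k) • P) =
        (n : k) • commutatorLeft k a P + commutatorLeft k a P := by
      ext c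
      simp [commutatorLeft_apply, Algebra.smul_def]
      ring
    rw [map_sub, hk, map_sum]
    simp only [commutatorLeft_mul, commutatorLeft_derivation, commutatorLeft_comm a,
      Finset.sum_add_distrib]
    have hs : ∀ i, commutatorLeft k (x i) P * Algebra.lmul k A (δ i a) =
        commutatorLeft k (δ i a) (commutatorLeft k (x i) P) + δ i a • commutatorLeft k (x i) P := by
      intro i
      rw [commutatorLeft_apply (δ i a), lmul_mul_eq_smul, sub_add_cancel]
    simp only [hs, Finset.sum_add_distrib]
    abel

theorem mem_diffOpLT_one {P : Module.End k A} (hP : P ∈ diffOpLT k A 1) :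
    P = Algebra.lmul k A (P 1) := by
  ext a
  have := LinearMap.congr_fun ((Submodule.mem_bot k).1 (mem_diffOpLT_succ.1 hP a)) 1
  simpa [sub_eq_zero, mul_comm a] using this

end DiffOp

/-! ### Projectivity of the order filtration and flatness in characteristic zero. -/

section Flat

variable {k A : Type*} [Field k] [CharZero k] [CommRing A] [Algebra k A]

/-- The operators of order `< n + 1` form a retract of a sum of copies of the module of operators of
order `< n`, by Euler's identity. -/
theorem IsDualFamily.projective_diffOpLTModule {ι : Type*} [Fintype ι] {x : ι → A}
    {δ : ι → Derivation k A A} (h : IsDualFamily x δ) (n : ℕ) :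
    Module.Projective A (diffOpLTModule k A n) := by
  induction n with
  | zero =>
    have : Subsingleton (diffOpLTModule k A 0) :=
      ⟨fun P Q => Subtype.ext (((Submodule.mem_bot k).1 P.2).trans
        ((Submodule.mem_bot k).1 Q.2).symm)⟩
    infer_instance
  | succ n ih =>
    -- The retraction divides by `n`, so operators of order `< 1` are treated apart: they are the
    -- functions, via `P ↦ P 1`.
    rcases Nat.eq_zero_or_pos n with rfl | hn
    · refine Module.Projective.of_split (M := A)
        { toFun := fun P => P.1 1
          map_add' := fun _ _ => rfl
          map_smul' := fun _ _ => rfl }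
        { toFun := fun a => ⟨Algebra.lmul k A a, lmul_mem_diffOpLT k a⟩
          map_add' := fun a b => Subtype.ext (map_add _ a b)
          map_smul' := fun a b => Subtype.ext (map_mul _ a b) } ?_
      ext1 P
      exact Subtype.ext (mem_diffOpLT_one P.2).symm
    · have hn' : (n : k) ≠ 0 := Nat.cast_ne_zero.2 hn.ne'
      let R : Module.End k A →ₗ[A] Module.End k A :=
        { toFun := fun P => (n : k) • P - ∑ i, commutatorLeft k (x i) P * (δ i : A →ₗ[k] A)
          map_add' := fun P Q => by
            simp only [smul_add, map_add, add_mul, Finset.sum_add_distrib]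
            abel
          map_smul' := fun a P => by
            simp only [map_smul, smul_mul_assoc, ← Finset.smul_sum, smul_sub, smul_comm a,
              RingHom.id_apply] }
      let S : (ι → Module.End k A) × Module.End k A →ₗ[A] Module.End k A :=
        { toFun := fun Q => (n : k)⁻¹ • ((∑ i, Q.1 i * (δ i : A →ₗ[k] A)) + Q.2)
          map_add' := fun P Q => by
            simp only [Prod.fst_add, Prod.snd_add, Pi.add_apply, add_mul, Finset.sum_add_distrib,
              ← smul_add]
            congr 1
            abel
          map_smul' := fun a P => by
            simp only [Prod.smul_fst, Prod.smul_snd, Pi.smul_apply, smul_mul_assoc,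
              ← Finset.smul_sum, ← smul_add, smul_comm a, RingHom.id_apply] }
      let f : diffOpLTModule k A (n + 1) →ₗ[A]
          (ι → diffOpLTModule k A n) × diffOpLTModule k A n :=
        LinearMap.prod
          (LinearMap.pi fun i => ((commutatorLeft k (x i)).comp (Submodule.subtype _)).codRestrict _
            fun P => commutatorLeft_mem P.2 _)
          ((R.comp (Submodule.subtype _)).codRestrict _ fun P => h.euler_mem n P.2)
      let g : (ι → diffOpLTModule k A n) × diffOpLTModule k A n →ₗ[A]
          diffOpLTModule k A (n + 1) :=
        (S.comp (LinearMap.prodMap (LinearMap.compLeft (Submodule.subtype _) ι)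
          (Submodule.subtype _))).codRestrict _ fun Q =>
          (diffOpLT k A (n + 1)).smul_mem _ (add_mem
            (sum_mem fun i _ => mul_derivation_mem_diffOpLT _ (Q.1 i).2)
            (diffOpLT_le_succ k A n Q.2.2))
      -- The product is a direct sum of copies indexed by `Option ι`, with `none` for the Euler
      -- remainder.
      have : Module.Projective A ((ι → diffOpLTModule k A n) × diffOpLTModule k A n) :=
        Module.Projective.of_equiv (DFinsupp.linearEquivFunOnFintype (R := A)
          (M := fun _ : Option ι => diffOpLTModule k A n) ≪≫ₗ
            LinearEquiv.piOptionEquivProd A ≪≫ₗ LinearEquiv.prodComm A _ _)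
      refine Module.Projective.of_split f g ?_
      ext1 P
      refine Subtype.ext ?_
      change (n : k)⁻¹ • ((∑ i, commutatorLeft k (x i) P.1 * (δ i : A →ₗ[k] A)) +
        ((n : k) • P.1 - ∑ i, commutatorLeft k (x i) P.1 * (δ i : A →ₗ[k] A))) = P.1
      rw [add_sub_cancel, smul_smul, inv_mul_cancel₀ hn', one_smul]

/-- The left `A`-module structure on the ring of differential operators. -/
abbrev diffOpModule (k A : Type*) [CommRing k] [CommRing A] [Algebra k A] :
    Module A (diffOp k A) :=
  Module.compHom _ (diffOpOfFun k A : A →+* diffOp k A)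

/-- By the equational criterion, flatness concerns one finite relation at a time, and such a
relation already lives in a single projective step of the order filtration. -/
theorem flat_diffOp (k A : Type*) [Field k] [CharZero k] [CommRing A] [Algebra k A]
    [Algebra.Smooth k A] :
    letI := diffOpModule k A
    Module.Flat A (diffOp k A) := by
  let := diffOpModule k A
  obtain ⟨s, δ, h⟩ := exists_isDualFamily k A
  refine Module.Flat.of_forall_isTrivialRelation (R := A) (M := diffOp k A) fun {l f x} hx => ?_
  choose m hm using fun i => (x i).2
  let n := Finset.univ.sup m
  have hn : ∀ i, (x i).1 ∈ diffOpLT k A n := fun i =>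
    diffOpLT_mono k A (Finset.le_sup (Finset.mem_univ i)) (hm i)
  have := h.projective_diffOpLTModule n
  let y : Fin l → diffOpLTModule k A n := fun i => ⟨(x i).1, hn i⟩
  let j : diffOpLTModule k A n →ₗ[A] diffOp k A :=
    { toFun := fun P => ⟨P.1, n, P.2⟩
      map_add' := fun _ _ => rfl
      map_smul' := fun _ _ => rfl }
  have hj : Function.Injective j := fun P Q hPQ => 
    Subtype.ext (show (j P).1 = (j Q).1 by rw [hPQ])
  have hy : ∑ i, f i • y i = 0 := hj <| by
    rw [map_sum, map_zero, ← hx]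
    exact Finset.sum_congr rfl fun i _ => map_smul j _ _
  obtain ⟨κ, a, z, hz, ha⟩ := Module.Flat.isTrivialRelation_of_sum_smul_eq_zero
    (R := A) (M := diffOpLTModule k A n) hy
  refine ⟨κ, a, fun i => j (z i), fun i => ?_, ha⟩
  rw [show x i = j (y i) from rfl, hz i, map_sum]
  exact Finset.sum_congr rfl fun i _ => map_smul j _ _

end Flat

/-! ### Modules with resolutions by finitely generated projective modules -/

section FinitelyPresented

open scoped TensorProduct

/-- `M` has a partial projective resolution of length `n` by finitely generated projectives. -/
def HasFiniteProjectiveResolution {B : Type u} [Ring B] : ℕ → ModuleCat.{u} B → Prop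
  | 0, _ => True
  | n + 1, M => ∃ (N F : ModuleCat.{u} B) (i : N ⟶ F) (p : F ⟶ M) (w : i ≫ p = 0),
      (ShortComplex.mk i p w).ShortExact ∧ Projective F ∧ Module.Finite B F ∧
        HasFiniteProjectiveResolution n N

theorem HasFiniteProjectiveResolution.of_exact {B : Type u} [Ring B] {n : ℕ} {N F M : Type u}
    [AddCommGroup N] [AddCommGroup F] [AddCommGroup M] [Module B N] [Module B F] [Module B M]
    [Module.Projective B F] [Module.Finite B F] {i : N →ₗ[B] F} {p : F →ₗ[B] M}
    (hi : Function.Injective i) (hp : Function.Surjective p) (h : Function.Exact i p)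
    (hN : HasFiniteProjectiveResolution n (ModuleCat.of B N)) :
    HasFiniteProjectiveResolution (n + 1) (ModuleCat.of B M) :=
  ⟨ModuleCat.of B N, ModuleCat.of B F, ModuleCat.ofHom i, ModuleCat.ofHom p,
    ModuleCat.hom_ext h.linearMap_comp_eq_zero, ModuleCat.shortComplex_shortExact _ h hi hp,
    inferInstance, ‹_›, hN⟩

variable {A R : Type u} [CommRing A] [Ring R] [Module A R] [IsScalarTower A R R]

/-- The map `R ⊗ f` as a map of right `R`-modules. -/
def lTensorRight (R : Type*) {A : Type*} [CommRing A] [Ring R] [Module A R] [IsScalarTower A R R]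
    {N N' : Type*} [AddCommGroup N] [AddCommGroup N'] [Module A N] [Module A N']
    (f : N →ₗ[A] N') : R ⊗[A] N →ₗ[Rᵐᵒᵖ] R ⊗[A] N' :=
  { f.lTensor R with
    map_smul' := fun r x => by
      change f.lTensor R (r • x) = r • f.lTensor R x
      induction x with
      | zero => simp
      | tmul x y => rw [TensorProduct.smul_tmul', LinearMap.lTensor_tmul, LinearMap.lTensor_tmul,
          TensorProduct.smul_tmul']
      | add x y hx hy => rw [smul_add, map_add, hx, hy, map_add, smul_add] }

/-- The identification of `R ⊗ A ^ ι` with a free right `R`-module. -/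
def tensorPiToPi (A R ι : Type*) [CommRing A] [Ring R] [Module A R] [IsScalarTower A R R] :
    R ⊗[A] (ι → A) →ₗ[Rᵐᵒᵖ] (ι → Rᵐᵒᵖ) :=
  let f : R ⊗[A] (ι → A) →ₗ[A] (ι → R) := TensorProduct.lift
    (LinearMap.mk₂ A (fun r v i => v i • r) (fun _ _ _ => funext fun _ => smul_add _ _ _)
      (fun _ _ _ => funext fun _ => smul_comm _ _ _)
      (fun _ _ _ => funext fun _ => add_smul _ _ _)
      (fun _ _ _ => funext fun _ => mul_smul _ _ _))
  { toFun := fun x i => MulOpposite.op (f x i)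
    map_add' := fun x y => by simp only [map_add]; rfl
    map_smul' := fun r x => by
      have : f (r • x) = r • f x := by
        induction x with
        | zero => simp
        | tmul x y =>
          ext i
          simp only [f, TensorProduct.smul_tmul', TensorProduct.lift.tmul, LinearMap.mk₂_apply,
            Pi.smul_apply]
          exact smul_comm _ _ _
        | add x y hx hy => rw [smul_add, map_add, hx, hy, map_add, smul_add]
      rw [this]
      rfl }

/-- The map from a free right `R`-module to `R ⊗ A ^ ι`. -/
noncomputable def piToTensorPi (A R ι : Type*) [CommRing A] [Ring R] [Module A R]
    [IsScalarTower A R R] [Fintype ι] [DecidableEq ι] :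
    (ι → Rᵐᵒᵖ) →ₗ[Rᵐᵒᵖ] R ⊗[A] (ι → A) :=
  Fintype.linearCombination Rᵐᵒᵖ fun i : ι => (1 : R) ⊗ₜ[A] (Pi.single i 1 : ι → A)

theorem piToTensorPi_comp_tensorPiToPi (A R ι : Type*) [CommRing A] [Ring R] [Module A R]
    [IsScalarTower A R R] [Fintype ι] [DecidableEq ι] :
    (piToTensorPi A R ι).comp (tensorPiToPi A R ι) = LinearMap.id := by
  ext x
  rw [LinearMap.comp_apply, LinearMap.id_apply]
  induction x with
  | zero => simp
  | tmul x v =>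
    have h : ∀ i, (tensorPiToPi A R ι (x ⊗ₜ v) i) = MulOpposite.op (v i • x) := fun _ => rfl
    rw [piToTensorPi, Fintype.linearCombination_apply]
    simp only [h, TensorProduct.smul_tmul', MulOpposite.smul_eq_mul_unop, MulOpposite.unop_op,
      one_mul]
    simp only [TensorProduct.smul_tmul, ← TensorProduct.tmul_sum]
    congr 1
    ext i
    simp [Finset.sum_apply, Pi.single_apply]
  | add x y hx hy => rw [map_add, map_add, hx, hy]

theorem projective_tensorPi (A R ι : Type*) [CommRing A] [Ring R] [Module A R]
    [IsScalarTower A R R] [Finite ι] : Module.Projective Rᵐᵒᵖ (R ⊗[A] (ι → A)) := by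
  classical
  cases nonempty_fintype ι
  exact Module.Projective.of_split _ _ (piToTensorPi_comp_tensorPiToPi A R ι)

theorem finite_tensorPi (A R ι : Type*) [CommRing A] [Ring R] [Module A R]
    [IsScalarTower A R R] [Finite ι] : Module.Finite Rᵐᵒᵖ (R ⊗[A] (ι → A)) := by
  classical
  cases nonempty_fintype ι
  exact Module.Finite.of_surjective (piToTensorPi A R ι)
    (Function.LeftInverse.surjective (LinearMap.congr_fun (piToTensorPi_comp_tensorPiToPi A R ι)))

/-- Over a noetherian ring the kernel of a finite free cover is again finite, and flatness of `R`
keeps the sequence exact after tensoring. -/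
theorem hasFiniteProjectiveResolution_tensor [IsNoetherianRing A] [Module.Flat A R] (n : ℕ)
    (N : Type u) [AddCommGroup N] [Module A N] [Module.Finite A N] :
    HasFiniteProjectiveResolution n (ModuleCat.of Rᵐᵒᵖ (R ⊗[A] N)) := by
  induction n generalizing N with
  | zero => trivial
  | succ n ih =>
    obtain ⟨r, f, hf⟩ := Module.Finite.exists_fin' A N
    have := projective_tensorPi A R (Fin r)
    have := finite_tensorPi A R (Fin r)
    exact .of_exact (i := lTensorRight R (LinearMap.ker f).subtype) (p := lTensorRight R f)
      (Module.Flat.lTensor_preserves_injective_linearMap _ Subtype.val_injective)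
      (LinearMap.lTensor_surjective R hf)
      (lTensor_exact R (LinearMap.exact_subtype_ker_map f) hf) (ih (LinearMap.ker f))

/-- The multiplication `R ⊗ I → R`, as a map of right `R`-modules. -/
def tensorIdealToRing (R : Type*) {A : Type*} [CommRing A] [Ring R] [Module A R]
    [IsScalarTower A R R] (I : Ideal A) : R ⊗[A] I →ₗ[Rᵐᵒᵖ] R :=
  { TensorProduct.lift ((LinearMap.lsmul A R).flip.compl₂ I.subtype) with
    map_smul' := fun r x => by
      change TensorProduct.lift _ (r • x) = r • TensorProduct.lift _ x
      induction x with
      | zero => simp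
      | tmul x y =>
        simp only [TensorProduct.smul_tmul', TensorProduct.lift.tmul, LinearMap.compl₂_apply,
          LinearMap.flip_apply, LinearMap.lsmul_apply]
        exact smul_comm _ _ _
      | add x y hx hy => rw [smul_add, map_add, hx, hy, map_add, smul_add] }

theorem tensorIdealToRing_tmul (I : Ideal A) (x : R) (a : I) :
    tensorIdealToRing R I (x ⊗ₜ a) = (a : A) • x :=
  rfl

theorem tensorIdealToRing_injective [Module.Flat A R] (I : Ideal A) :
    Function.Injective (tensorIdealToRing R I) := by
  have h := (TensorProduct.rid A R).injective.comp
    (Module.Flat.lTensor_preserves_injective_linearMap (M := R) I.subtype Subtype.val_injective)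
  convert h using 1
  ext x
  induction x with
  | zero => simp
  | tmul x y => simp [tensorIdealToRing_tmul]
  | add x y hx hy => rw [map_add, hx, hy]; simp

theorem range_tensorIdealToRing (I : Ideal A) :
    LinearMap.range (tensorIdealToRing R I) =
      Submodule.span Rᵐᵒᵖ ((fun a : A => a • (1 : R)) '' (I : Set A)) := by
  refine le_antisymm ?_ (Submodule.span_le.2 ?_)
  · rintro _ ⟨x, rfl⟩
    induction x with
    | zero => simp
    | tmul x y =>
      rw [tensorIdealToRing_tmul, show (y : A) • x = MulOpposite.op x • ((y : A) • (1 : R)) by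
        rw [MulOpposite.smul_eq_mul_unop, MulOpposite.unop_op, smul_mul_assoc, one_mul]]
      exact Submodule.smul_mem _ _ (Submodule.subset_span ⟨y, y.2, rfl⟩)
    | add x y hx hy => rw [map_add]; exact add_mem hx hy
  · rintro _ ⟨a, ha, rfl⟩
    exact ⟨1 ⊗ₜ ⟨a, ha⟩, tensorIdealToRing_tmul _ _ _⟩

/-- Flatness identifies the right ideal generated by `I` with `R ⊗ I`, which is thus the first
syzygy of the quotient. -/
theorem hasFiniteProjectiveResolution_rightQuotient [IsNoetherianRing A] [Module.Flat A R]
    (I : Ideal A) (n : ℕ) :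
    HasFiniteProjectiveResolution n
      (rightQuotient R ((fun a : A => a • (1 : R)) '' (I : Set A))) := by
  cases n with
  | zero => trivial
  | succ n =>
    have e : Rᵐᵒᵖ ≃ₗ[Rᵐᵒᵖ] R :=
      { toFun := MulOpposite.unop
        invFun := MulOpposite.op
        map_add' := fun _ _ => rfl
        map_smul' := fun _ _ => rfl }
    have : Module.Projective Rᵐᵒᵖ R := .of_equiv e
    have : Module.Finite Rᵐᵒᵖ R := .equiv e
    refine .of_exact (tensorIdealToRing_injective I) (Submodule.mkQ_surjective _) ?_
      (hasFiniteProjectiveResolution_tensor n I)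
    rw [LinearMap.exact_iff, Submodule.ker_mkQ, range_tensorIdealToRing]

end FinitelyPresented

theorem hasFiniteProjectiveResolution_canonicalDModule {k : Type*} {A : Type u} [Field k]
    [CharZero k] [CommRing A] [Algebra k A] [Algebra.Smooth k A] (I : Ideal A) (n : ℕ) :
    HasFiniteProjectiveResolution n (canonicalDModule k I) := by
  let := diffOpModule k A
  have : IsScalarTower A (diffOp k A) (diffOp k A) := ⟨fun a P Q => mul_assoc _ _ _⟩
  have := flat_diffOp k A
  have : IsNoetherianRing A := Algebra.FiniteType.isNoetherianRing k A
  convert hasFiniteProjectiveResolution_rightQuotient (R := diffOp k A) I n using 2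
  rw [canonicalDModule]
  congr 2

/-! ### Supports and torsion -/

section Support

variable {k : Type*} {A : Type u} [CommRing k] [CommRing A] [Algebra k A]

/-- The radical of the annihilator of `m` is the intersection of the primes containing it, and all
of these lie in the support. -/
theorem isSupportedOn_iff {I : Ideal A} {M : ModuleCat.{u} (diffOp k A)ᵐᵒᵖ} :
    IsSupportedOn I M ↔ ∀ m : M, ∀ f ∈ I, ∃ n : ℕ, diffOpOfFunOp k A f ^ n • m = 0 := by
  constructor
  · intro h m f hf
    by_contra! hn
    let N := (ModuleCat.restrictScalars (diffOpOfFunOp k A)).obj M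
    let m' : N := m
    have hrad : f ∉ (Submodule.span A {m'}).annihilator.radical := by
      rintro ⟨n, hfn⟩
      rw [Submodule.mem_annihilator_span_singleton] at hfn
      refine hn n ?_
      rw [← map_pow]
      exact hfn
    rw [Ideal.radical_eq_sInf, Submodule.mem_sInf] at hrad
    push Not at hrad
    obtain ⟨p, ⟨hp, hpp⟩, hfp⟩ := hrad
    refine hfp (h (a := ⟨p, hpp⟩) ?_ hf)
    exact Module.mem_support_iff'.2 ⟨m', fun r hr hrm =>
      hr (hp ((Submodule.mem_annihilator_span_singleton _ _).2 hrm))⟩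
  · intro h p hp f hf
    obtain ⟨m, hm⟩ := Module.mem_support_iff'.1 hp
    obtain ⟨n, hn⟩ := h m f hf
    by_contra hfp
    refine hm (f ^ n) (fun hfn => hfp (p.2.mem_of_pow_mem n hfn)) ?_
    rw [← map_pow] at hn
    exact hn

theorem IsSupportedOn.of_isZero {I : Ideal A} {M : ModuleCat.{u} (diffOp k A)ᵐᵒᵖ} (h : IsZero M) :
    IsSupportedOn I M := by
  have := ModuleCat.subsingleton_of_isZero h
  exact isSupportedOn_iff.2 fun m f _ => ⟨0, Subsingleton.elim _ _⟩

theorem isSupportedOn_canonicalDModule (I : Ideal A) :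
    IsSupportedOn I (canonicalDModule k I) := by
  refine isSupportedOn_iff.2 fun m f hf => ?_
  obtain ⟨P, rfl⟩ := Submodule.Quotient.mk_surjective _ m
  obtain ⟨n, hP⟩ := P.2
  -- The order bound serves as exponent: `P f ^ (n + 1) = [P, f] f ^ n + f P f ^ n`, where `[P, f]`
  -- has smaller order and the last term is in `I D`.
  refine ⟨n, ?_⟩
  suffices h : ∀ (n : ℕ) (P : diffOp k A), P.1 ∈ diffOpLT k A n →
      P * diffOpOfFun k A f ^ n ∈
        Submodule.span (diffOp k A)ᵐᵒᵖ (diffOpOfFun k A '' (I : Set A)) by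
    have := h n P hP
    rw [← map_pow] at this ⊢
    exact (Submodule.Quotient.mk_eq_zero _).2 this
  clear hP P n
  intro n
  induction n with
  | zero =>
    intro P hP
    rw [show P = 0 from Subtype.ext ((Submodule.mem_bot k).1 hP), zero_mul]
    exact zero_mem _
  | succ n ih =>
    intro P hP
    have h₁ := ih (P * diffOpOfFun k A f - diffOpOfFun k A f * P) (mem_diffOpLT_succ.1 hP f)
    have h₂ := Submodule.smul_mem (Submodule.span (diffOp k A)ᵐᵒᵖ (diffOpOfFun k A '' (I : Set A)))
      (MulOpposite.op (P * diffOpOfFun k A f ^ n)) (Submodule.subset_span ⟨f, hf, rfl⟩)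
    rw [MulOpposite.smul_eq_mul_unop, MulOpposite.unop_op] at h₂
    convert add_mem h₁ h₂ using 1
    have key {S : Type u} [Ring S] (p x : S) :
        p * x ^ (n + 1) = (p * x - x * p) * x ^ n + x * (p * x ^ n) := by
      rw [sub_mul, pow_succ', mul_assoc, mul_assoc, sub_add_cancel]
    exact key P (diffOpOfFun k A f)

/-- A nonzero module supported on `V(I)` has a nonzero element killed by `I`. -/
theorem IsSupportedOn.exists_killed [IsNoetherianRing A] {I : Ideal A}
    {M : ModuleCat.{u} (diffOp k A)ᵐᵒᵖ} (h : IsSupportedOn I M) (hM : Nontrivial M) :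
    ∃ m : M, m ≠ 0 ∧ ∀ f ∈ I, diffOpOfFunOp k A f • m = 0 := by
  classical
  let N := (ModuleCat.restrictScalars (diffOpOfFunOp k A)).obj M
  obtain ⟨m, hm⟩ := exists_ne (0 : M)
  let m' : N := m
  have hI : I ≤ (Submodule.span A {m'}).annihilator.radical := fun f hf => by
    obtain ⟨n, hn⟩ := isSupportedOn_iff.1 h m f hf
    refine ⟨n, (Submodule.mem_annihilator_span_singleton _ _).2 ?_⟩
    rw [← map_pow] at hn
    exact hn
  have hex : ∃ n : ℕ, ∀ f ∈ I ^ n, f • m' = 0 := by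
    obtain ⟨n, hn⟩ := Ideal.exists_pow_le_of_le_radical_of_fg hI (IsNoetherian.noetherian I)
    exact ⟨n, fun f hf => (Submodule.mem_annihilator_span_singleton _ _).1 (hn hf)⟩
  -- The least power of `I` killing `m` is not `I ^ 0`, which contains `1`; an element of the
  -- preceding power then moves `m` to the required element.
  have h0 : Nat.find hex ≠ 0 := fun h0 => hm <| by
    have := Nat.find_spec hex 1 (by rw [h0]; simp)
    rwa [one_smul] at this
  have hlt := Nat.find_min hex (Nat.sub_one_lt h0)
  push Not at hlt
  obtain ⟨g, hg, hgm⟩ := hlt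
  refine ⟨g • m', hgm, fun f hf => ?_⟩
  change f • g • m' = 0
  rw [smul_smul]
  refine Nat.find_spec hex _ ?_
  rw [← Nat.sub_one_add_one h0, pow_succ']
  exact Ideal.mul_mem_mul hf hg

/-- The map `D_X → M` given by an element of `M` killed by `I`. -/
theorem exists_canonicalDModule_hom {I : Ideal A} {M : ModuleCat.{u} (diffOp k A)ᵐᵒᵖ} {m : M}
    (hm : ∀ f ∈ I, diffOpOfFunOp k A f • m = 0) (hm0 : m ≠ 0) :
    ∃ φ : canonicalDModule k I ⟶ M, φ ≠ 0 := by
  let ψ : diffOp k A →ₗ[(diffOp k A)ᵐᵒᵖ] M :=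
    { toFun := fun P => MulOpposite.op P • m
      map_add' := fun P Q => by rw [MulOpposite.op_add, add_smul]
      map_smul' := fun P Q => by
        rw [MulOpposite.smul_eq_mul_unop, MulOpposite.op_mul, MulOpposite.op_unop, mul_smul]
        rfl }
  have hψ : Submodule.span (diffOp k A)ᵐᵒᵖ (diffOpOfFun k A '' (I : Set A)) ≤ LinearMap.ker ψ := by
    rw [Submodule.span_le]
    rintro _ ⟨f, hf, rfl⟩
    exact hm f hf
  refine ⟨ModuleCat.ofHom (Submodule.liftQ _ ψ hψ), fun h0 => hm0 ?_⟩
  have : ψ 1 = 0 :=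
    congr_arg (fun g : canonicalDModule k I ⟶ M => g.hom (Submodule.Quotient.mk 1)) h0
  simpa [ψ] using this

end Support

/-! ### Morphisms from single complexes in the derived category -/

section SingleComplexes

open DerivedCategory

variable {C : Type u} [Category.{v} C] [Abelian C]

/-- A chain map from a single complex on a projective object is null-homotopic if it is zero in
homology. -/
theorem nonempty_homotopy_zero_of_homologyMap_eq_zero {P : C} [Projective P] {p : ℤ}
    {K : CochainComplex C ℤ} (g : (HomologicalComplex.single C (.up ℤ) p).obj P ⟶ K)
    (hg : HomologicalComplex.homologyMap g p = 0) : Nonempty (Homotopy g 0) := by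
  let g' : (CochainComplex.singleFunctor C p).obj P ⟶ K := g
  obtain ⟨φ, hφ, hφg⟩ := CochainComplex.HomComplex.Cocycle.fromSingleMk_surjective
    (CochainComplex.HomComplex.Cocycle.ofHom g') p (add_zero p) (p + 1) rfl
  have hgf : g.f p = (HomologicalComplex.singleObjXSelf (.up ℤ) p P).hom ≫ φ := by
    change g'.f p = _
    have := congr_arg (fun z => z.1.v p p (add_zero p)) hφg
    simpa [CochainComplex.HomComplex.Cocycle.fromSingleMk] using this.symm
  let z : P ⟶ K.cycles p := K.liftCycles φ (p + 1) (by simp) hφ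
  have hz : z ≫ K.homologyπ p = 0 := by
    have h1 : (HomologicalComplex.singleObjCyclesSelfIso (.up ℤ) p P).hom ≫ z =
        HomologicalComplex.cyclesMap g p := by
      rw [← cancel_mono (K.iCycles p)]
      simp only [z, Category.assoc, HomologicalComplex.liftCycles_i,
        HomologicalComplex.cyclesMap_i, HomologicalComplex.singleObjCyclesSelfIso_hom, hgf]
    rw [← cancel_epi (HomologicalComplex.singleObjCyclesSelfIso (.up ℤ) p P).hom, ← Category.assoc,
      h1, ← HomologicalComplex.homologyπ_naturality, comp_zero, hg, comp_zero]
  have hex : (ShortComplex.mk (K.toCycles (p - 1) p) (K.homologyπ p) (by simp)).Exact :=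
    ShortComplex.exact_of_g_is_cokernel _ (K.homologyIsCokernel (p - 1) p (by simp))
  -- Being zero in homology, the cycle `z` lifts through the boundaries by projectivity; the lift is
  -- the homotopy.
  let ψ := hex.liftFromProjective z hz
  have hψ : ψ ≫ K.d (p - 1) p = φ := by
    rw [← K.toCycles_i, ← Category.assoc]
    have : ψ ≫ K.toCycles (p - 1) p = z := hex.liftFromProjective_comp z hz
    rw [this, HomologicalComplex.liftCycles_i]
  have hmain : CochainComplex.HomComplex.Cochain.ofHom g' =
      CochainComplex.HomComplex.δ (-1) 0
        (CochainComplex.HomComplex.Cochain.fromSingleMk ψ (by omega)) +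
      CochainComplex.HomComplex.Cochain.ofHom 0 := by
    rw [CochainComplex.HomComplex.Cochain.ofHom_zero, add_zero,
      CochainComplex.HomComplex.Cochain.δ_fromSingleMk _ _ _ p (add_zero p), hψ]
    exact (congr_arg Subtype.val hφg).symm
  exact ⟨(CochainComplex.HomComplex.Cochain.equivHomotopy _ _).symm ⟨_, hmain⟩⟩

variable [HasDerivedCategory.{w} C]

theorem homologyMap_eq_zero_of_map_Q {K L : CochainComplex C ℤ} (g : K ⟶ L) (n : ℤ)
    (h : (homologyFunctor C n).map (Q.map g) = 0) : HomologicalComplex.homologyMap g n = 0 := by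
  have h' := homologyFunctorFactors_hom_naturality g n
  rw [h, zero_comp] at h'
  exact (cancel_epi ((homologyFunctorFactors C n).hom.app K)).1 (h'.symm.trans comp_zero.symm)

/-- A single complex on a projective object is K-projective, so `f` is represented by a chain map,
to which the previous homotopy applies. -/
theorem singleFunctor_hom_eq_zero {P : C} [Projective P] {p : ℤ} {X : DerivedCategory C}
    (f : (singleFunctor C p).obj P ⟶ X) (hf : (homologyFunctor C p).map f = 0) : f = 0 := by
  obtain ⟨K, ⟨e⟩⟩ : ∃ K, Nonempty (X ≅ Q.obj K) := ⟨_, ⟨(Q.objObjPreimageIso X).symm⟩⟩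
  let S := (CochainComplex.singleFunctor C p).obj P
  have : S.IsStrictlyLE p := by
    dsimp [S, CochainComplex.singleFunctor, CochainComplex.singleFunctors]
    infer_instance
  have hproj : ∀ n, Projective (S.X n) := fun n => by
    by_cases h : n = p
    · subst h
      exact Projective.of_iso (HomologicalComplex.singleObjXSelf (.up ℤ) n P).symm inferInstance
    · exact Projective.of_iso
        (((HomologicalComplex.isZero_single_obj_X (.up ℤ) p P n h).isoZero).symm) inferInstance
  have : S.IsKProjective := CochainComplex.isKProjective_of_projective S p
  let f' : Q.obj S ⟶ Q.obj K := f ≫ e.hom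
  suffices h : f' = 0 by
    rw [← cancel_mono e.hom, zero_comp]
    exact h
  obtain ⟨h, hh⟩ := (CochainComplex.IsKProjective.Qh_map_bijective S
    ((HomotopyCategory.quotient _ _).obj K)).surjective
      ((quotientCompQhIso C).hom.app S ≫ f' ≫ (quotientCompQhIso C).inv.app K)
  obtain ⟨g, rfl⟩ := (HomotopyCategory.quotient C (.up ℤ)).map_surjective h
  have hfg : f' = Q.map g := by
    have := (quotientCompQhIso C).hom.naturality g
    rw [Functor.comp_map, hh] at this
    simpa using this
  have hf' : (homologyFunctor C p).map f' = 0 := by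
    change (homologyFunctor C p).map (f ≫ e.hom) = 0
    rw [Functor.map_comp, hf, zero_comp]
  obtain ⟨H⟩ := nonempty_homotopy_zero_of_homologyMap_eq_zero g 
    (homologyMap_eq_zero_of_map_Q g p (hfg ▸ hf'))
  exact hfg.trans ((Q_map_eq_of_homotopy C H).trans (Q.map_zero _ _))

/-- A nonzero morphism to the lowest homology object of `X` gives a nonzero morphism to `X`. -/
theorem exists_singleFunctor_hom_ne_zero {M : C} {n : ℤ} {X : DerivedCategory C} [X.IsGE n]
    (φ : M ⟶ (homologyFunctor C n).obj X) (hφ : φ ≠ 0) :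
    ∃ f : (singleFunctor C n).obj M ⟶ X, f ≠ 0 := by
  obtain ⟨K, _, ⟨e⟩⟩ := X.exists_iso_Q_obj_of_isGE n
  let φ' : M ⟶ K.homology n :=
    φ ≫ (homologyFunctor C n).map e.hom ≫ (homologyFunctorFactors C n).hom.app K
  -- Nothing maps into the lowest degree, so homology there is cycles and a map to it is already a
  -- chain map.
  have hd : K.d (n - 1) n = 0 := (K.isZero_of_isStrictlyGE n (n - 1) (by omega)).eq_of_src _ _
  have : IsIso (K.homologyπ n) := K.isIso_homologyπ (n - 1) n (by simp) hd
  let z : M ⟶ K.cycles n := φ' ≫ inv (K.homologyπ n)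
  let g : (HomologicalComplex.single C (.up ℤ) n).obj M ⟶ K :=
    HomologicalComplex.mkHomFromSingle (z ≫ K.iCycles n) (fun i _ => by simp)
  have hg : HomologicalComplex.homologyMap g n =
      (HomologicalComplex.singleObjHomologySelfIso (.up ℤ) n M).hom ≫ φ' := by
    rw [← cancel_epi (HomologicalComplex.homologyπ _ n),
      HomologicalComplex.homologyπ_naturality,
      HomologicalComplex.homologyπ_singleObjHomologySelfIso_hom_assoc]
    have : HomologicalComplex.cyclesMap g n =
        (HomologicalComplex.singleObjCyclesSelfIso (.up ℤ) n M).hom ≫ z := by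
      rw [← cancel_mono (K.iCycles n)]
      simp [g, HomologicalComplex.singleObjCyclesSelfIso_hom]
    rw [this]
    simp [z]
  let f' : (singleFunctor C n).obj M ⟶ Q.obj K := Q.map g
  refine ⟨f' ≫ e.inv, fun h => hφ ?_⟩
  have hf' : Q.map g = 0 := by
    have : f' = 0 := by rw [← cancel_mono e.inv, h, zero_comp]
    exact this
  have h0 : HomologicalComplex.homologyMap g n = 0 :=
    homologyMap_eq_zero_of_map_Q g n (by rw [hf', Functor.map_zero])
  rw [hg] at h0
  have : φ' = 0 := by
    rwa [← cancel_epi (HomologicalComplex.singleObjHomologySelfIso (.up ℤ) n M).hom, comp_zero]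
  have hmono : Mono ((homologyFunctor C n).map e.hom ≫ (homologyFunctorFactors C n).hom.app K) :=
    inferInstance
  rwa [← cancel_mono ((homologyFunctor C n).map e.hom ≫ (homologyFunctorFactors C n).hom.app K),
    zero_comp]

end SingleComplexes

/-! ### Morphisms from modules with finite projective resolutions -/

section Eventually

open DerivedCategory Filter

variable {B : Type u} [Ring B] [HasDerivedCategory.{w} (ModuleCat.{u} B)]

/-- Such an `f` is determined by its effect on homology, hence by the images of finitely many
generators of `F`. -/
theorem eventually_comp_eq_of_projective {S : DerivedCategory (ModuleCat.{u} B)} {T : Type*}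
    {l : Filter T} {e : T → (S ⟶ S)}
    (hH : ∀ (n : ℤ) (x : (homologyFunctor (ModuleCat.{u} B) n).obj S),
      ∀ᶠ t in l, (homologyFunctor (ModuleCat.{u} B) n).map (e t) x = x)
    {F : ModuleCat.{u} B} [Projective F] [Module.Finite B F] {n : ℤ}
    (f : (singleFunctor (ModuleCat.{u} B) n).obj F ⟶ S) : ∀ᶠ t in l, f ≫ e t = f := by
  let i := (singleFunctorCompHomologyFunctorIso (ModuleCat.{u} B) n).app F
  have : Module.Finite B ((homologyFunctor (ModuleCat.{u} B) n).obj
      ((singleFunctor (ModuleCat.{u} B) n).obj F)) :=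
    .equiv (M := F) i.symm.toLinearEquiv
  obtain ⟨G, hG⟩ := Module.finite_def.1 this
  have hev : ∀ᶠ t in l, ∀ x ∈ G, (homologyFunctor (ModuleCat.{u} B) n).map (e t)
      ((homologyFunctor (ModuleCat.{u} B) n).map f x) =
        (homologyFunctor (ModuleCat.{u} B) n).map f x :=
    (Filter.eventually_all_finset G).2 fun x _ => hH n _
  filter_upwards [hev] with t ht
  rw [← sub_eq_zero]
  refine singleFunctor_hom_eq_zero _ ?_
  rw [Functor.map_sub, sub_eq_zero, Functor.map_comp]
  exact ModuleCat.hom_ext (LinearMap.ext_on hG ht)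

/-- Morphisms to a bounded below complex from a module with a long enough resolution by finitely
generated projectives are determined by finitely many of the idempotents `e t`. -/
theorem eventually_comp_eq {S : DerivedCategory (ModuleCat.{u} B)} {T : Type*}
    [Preorder T] [IsDirectedOrder T] [Nonempty T] {e : T → (S ⟶ S)}
    (he : ∀ s t, s ≤ t → e s ≫ e t = e s)
    (hH : ∀ (n : ℤ) (x : (homologyFunctor (ModuleCat.{u} B) n).obj S),
      ∀ᶠ t in atTop, (homologyFunctor (ModuleCat.{u} B) n).map (e t) x = x)
    (a : ℤ) [S.IsGE a] (k : ℕ) (M : ModuleCat.{u} B) (hM : HasFiniteProjectiveResolution k M)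
    (n : ℤ) (hn : n < a + k) (f : (singleFunctor (ModuleCat.{u} B) n).obj M ⟶ S) :
    ∀ᶠ t in atTop, f ≫ e t = f := by
  induction k generalizing M n with
  | zero =>
    -- Now `n < a`, and the t-structure leaves no nonzero morphisms.
    have : f = 0 := TStructure.t.zero f n a (by simpa using hn)
    simp [this]
  | succ k ih =>
    obtain ⟨N, F, i, p, w, hS, hF, hF', hN⟩ := hM
    have hT := triangleOfSES_distinguished
      (hS.map_of_exact (HomologicalComplex.single (ModuleCat.{u} B) (ComplexShape.up ℤ) n))
    let π : (singleFunctor (ModuleCat.{u} B) n).obj F ⟶ (singleFunctor (ModuleCat.{u} B) n).obj M :=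
      Q.map
      ((HomologicalComplex.single (ModuleCat.{u} B) (ComplexShape.up ℤ) n).map p)
    obtain ⟨s, hs⟩ := (eventually_comp_eq_of_projective hH (π ≫ f)).exists
    have hπ : π ≫ (f - f ≫ e s) = 0 := by
      rw [Preadditive.comp_sub, ← Category.assoc, hs, sub_self]
    obtain ⟨δ, g, hg⟩ : ∃ (δ : (singleFunctor (ModuleCat.{u} B) n).obj M ⟶
        ((singleFunctor (ModuleCat.{u} B) n).obj N)⟦(1 : ℤ)⟧)
        (g : ((singleFunctor (ModuleCat.{u} B) n).obj N)⟦(1 : ℤ)⟧ ⟶ S), f - f ≫ e s = δ ≫ g :=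
      -- The part of `f` missed by `e s` vanishes on `F`, so it factors through the shifted syzygy,
      -- a module in degree `n - 1`, where induction applies.
      ⟨_, Pretriangulated.Triangle.yoneda_exact₃ _ hT (f - f ≫ e s) hπ⟩
    let α := ((singleFunctors (ModuleCat.{u} B)).shiftIso 1 (n - 1) n (by omega)).app N
    filter_upwards [ih N hN (n - 1) (by push_cast at hn; omega) (α.inv ≫ g),
      eventually_ge_atTop s] with t ht hst
    have hg' : g ≫ e t = g := by
      rwa [Category.assoc, cancel_epi] at ht
    have h₁ : (f - f ≫ e s) ≫ e t = f - f ≫ e s := by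
      rw [hg, Category.assoc, hg']
    rw [Preadditive.sub_comp, Category.assoc, he s t hst] at h₁
    exact sub_left_injective h₁

end Eventually

/-! ### Approximation of coproducts in the derived category -/

section Coproducts

open DerivedCategory Filter

variable {B : Type u} [Ring B] {J : Type u} [DecidableEq J]

/-- The endomorphism of a coproduct of complexes given by the projection to a finite subsum. -/
noncomputable def coproductProjection (K : J → CochainComplex (ModuleCat.{u} B) ℤ) (t : Finset J) :
    (∐ K) ⟶ ∐ K :=
  ∑ j ∈ t, Sigma.π K j ≫ Sigma.ι K j

theorem ι_coproductProjection (K : J → CochainComplex (ModuleCat.{u} B) ℤ) {t : Finset J} {j : J}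
    (hj : j ∈ t) : Sigma.ι K j ≫ coproductProjection K t = Sigma.ι K j := by
  rw [coproductProjection, Preadditive.comp_sum, Finset.sum_eq_single_of_mem j hj, ← Category.assoc,
    Sigma.ι_π_eq_id, Category.id_comp]
  intro i _ hij
  rw [← Category.assoc, Sigma.ι_π_of_ne _ hij.symm, zero_comp]

/-- The eventually fixed elements form a submodule containing every summand, so the quotient by it
vanishes by the universal property of the coproduct. -/
theorem eventually_coproductProjection_f_apply (K : J → CochainComplex (ModuleCat.{u} B) ℤ) (n : ℤ)
    (z : (∐ K).X n) : ∀ᶠ t in atTop, (coproductProjection K t).f n z = z := by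
  let N : Submodule B ((∐ K).X n) :=
    { carrier := {z | ∀ᶠ t in atTop, (coproductProjection K t).f n z = z}
      add_mem' := fun ha hb => by
        filter_upwards [ha, hb] with t hta htb
        rw [map_add, hta, htb]
      zero_mem' := by simp
      smul_mem' := fun r a ha => by
        filter_upwards [ha] with t hta
        rw [map_smul, hta] }
  suffices h : ModuleCat.ofHom N.mkQ = 0 by
    have : N.mkQ z = 0 := congr_arg (fun g => g.hom z) h
    rwa [Submodule.mkQ_apply, Submodule.Quotient.mk_eq_zero] at this
  refine (isColimitOfPreserves (HomologicalComplex.eval (ModuleCat.{u} B) (ComplexShape.up ℤ) n)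
    (colimit.isColimit (Discrete.functor K))).hom_ext fun ⟨j⟩ => ?_
  ext x
  refine (Submodule.Quotient.mk_eq_zero _).2 ?_
  filter_upwards [eventually_ge_atTop {j}] with t ht
  have h := ι_coproductProjection K (Finset.singleton_subset_iff.1 ht)
  exact congr_arg (fun g : K j ⟶ ∐ K => (g.f n).hom x) h

theorem eventually_homologyMap_coproductProjection_apply
    (K : J → CochainComplex (ModuleCat.{u} B) ℤ) (n : ℤ) (y : (∐ K).homology n) :
    ∀ᶠ t in atTop, HomologicalComplex.homologyMap (coproductProjection K t) n y = y := by
  obtain ⟨z, rfl⟩ := (ModuleCat.epi_iff_surjective ((∐ K).homologyπ n)).1 inferInstance y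
  filter_upwards [eventually_coproductProjection_f_apply K n ((∐ K).iCycles n z)] with t ht
  have h₁ : HomologicalComplex.cyclesMap (coproductProjection K t) n z = z := by
    refine (ModuleCat.mono_iff_injective ((∐ K).iCycles n)).1 inferInstance ?_
    rw [← ht]
    exact congr_arg (fun g => g.hom z)
      (HomologicalComplex.cyclesMap_i (coproductProjection K t) n)
  have h₂ := congr_arg (fun g => g.hom z)
    (HomologicalComplex.homologyπ_naturality (coproductProjection K t) n)
  exact h₂.trans (congr_arg ((∐ K).homologyπ n) h₁)

variable [HasDerivedCategory.{w} (ModuleCat.{u} B)]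

/-- The target is represented once and for all; the calculus of right fractions adjusts only the
sources, so one `L` serves all `j`. -/
theorem exists_chainMap_representatives {J : Type*} {C : DerivedCategory (ModuleCat.{u} B)}
    {X : J → DerivedCategory (ModuleCat.{u} B)} (ι : ∀ j, X j ⟶ C) :
    ∃ (L : CochainComplex (ModuleCat.{u} B) ℤ) (K : J → CochainComplex (ModuleCat.{u} B) ℤ)
      (e : C ≅ Q.obj L) (e' : ∀ j, X j ≅ Q.obj (K j)) (κ : ∀ j, K j ⟶ L),
      ∀ j, ι j ≫ e.hom = (e' j).hom ≫ Q.map (κ j) := by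
  let e := (Q.objObjPreimageIso C).symm
  have h : ∀ j, ∃ (K : CochainComplex (ModuleCat.{u} B) ℤ) (e' : X j ≅ Q.obj K)
      (κ : K ⟶ Q.objPreimage C), ι j ≫ e.hom = e'.hom ≫ Q.map κ := fun j => by
    obtain ⟨K, s, _, g, hg⟩ := right_fac ((Q.objObjPreimageIso (X j)).hom ≫ ι j ≫ e.hom)
    refine ⟨K, (Q.objObjPreimageIso (X j)).symm ≪≫ (asIso (Q.map s)).symm, g, ?_⟩
    simp [← hg]
  choose K e' κ hκ using h
  exact ⟨_, K, e, e', κ, hκ⟩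

/-- Every family of morphisms `X j ⟶ C` factors through an object `S` whose homology is generated by
the homology of the objects `X j`. -/
theorem exists_coproduct_factorization {C : DerivedCategory (ModuleCat.{u} B)}
    {X : J → DerivedCategory (ModuleCat.{u} B)} (ι : ∀ j, X j ⟶ C) :
    ∃ (S : DerivedCategory (ModuleCat.{u} B)) (i : ∀ j, X j ⟶ S) (π : ∀ j, S ⟶ X j) (ψ : S ⟶ C),
      (∀ j, i j ≫ ψ = ι j) ∧ ∀ (n : ℤ) (y : (homologyFunctor (ModuleCat.{u} B) n).obj S),
        ∃ t : Finset J, (homologyFunctor (ModuleCat.{u} B) n).map (∑ j ∈ t, π j ≫ i j) y = y := by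
  obtain ⟨L, K, e, e', κ, h⟩ := exists_chainMap_representatives ι
  refine ⟨Q.obj (∐ K), fun j => (e' j).hom ≫ Q.map (Sigma.ι K j),
    fun j => Q.map (Sigma.π K j) ≫ (e' j).inv, Q.map (Sigma.desc κ) ≫ e.inv, fun j => ?_,
    fun n y => ?_⟩
  · rw [Category.assoc, ← Functor.map_comp_assoc, Sigma.ι_desc, ← Category.assoc, ← h j,
      Category.assoc, Iso.hom_inv_id, Category.comp_id]
  · let q := (homologyFunctorFactors (ModuleCat.{u} B) n).app (∐ K)
    obtain ⟨t, ht⟩ := (eventually_homologyMap_coproductProjection_apply K n (q.hom y)).exists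
    refine ⟨t, ?_⟩
    have hs : ∑ j ∈ t, (Q.map (Sigma.π K j) ≫ (e' j).inv) ≫ (e' j).hom ≫ Q.map (Sigma.ι K j) =
        Q.map (coproductProjection K t) := by
      simp [coproductProjection, Functor.map_sum]
    rw [hs]
    refine (ModuleCat.mono_iff_injective q.hom).1 inferInstance ?_
    have := congr_arg (fun g => g.hom y)
      (homologyFunctorFactors_hom_naturality (coproductProjection K t) n)
    exact this.trans ht

end Coproducts

/-! ### Compactness in preadditive categories -/

section Compactness

variable {T : Type*} [Category* T] [Preadditive T] {J : Type*} {X : J → T} {c : Cofan X}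

/-- The projection from a coproduct to one of its terms. -/
noncomputable def cofanProjection [DecidableEq J] (hc : IsColimit c) (j : J) : c.pt ⟶ X j :=
  Cofan.IsColimit.desc hc (Function.update (fun _ => 0) j (𝟙 _))

theorem inj_cofanProjection_self [DecidableEq J] (hc : IsColimit c) (j : J) :
    c.inj j ≫ cofanProjection hc j = 𝟙 _ := by
  simp [cofanProjection]

theorem inj_cofanProjection_of_ne [DecidableEq J] (hc : IsColimit c) {i j : J} (h : i ≠ j) :
    c.inj i ≫ cofanProjection hc j = 0 := by
  simp [cofanProjection, Function.update_of_ne h]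

/-- The endomorphism of a coproduct given by the projection to a finite subsum. -/
noncomputable def cofanIdempotent [DecidableEq J] (hc : IsColimit c) (t : Finset J) : c.pt ⟶ c.pt :=
  ∑ j ∈ t, cofanProjection hc j ≫ c.inj j

theorem inj_cofanIdempotent [DecidableEq J] (hc : IsColimit c) {t : Finset J} {j : J} (hj : j ∈ t) :
    c.inj j ≫ cofanIdempotent hc t = c.inj j := by
  rw [cofanIdempotent, Preadditive.comp_sum, Finset.sum_eq_single_of_mem j hj, ← Category.assoc,
    inj_cofanProjection_self, Category.id_comp]
  intro i _ hij
  rw [← Category.assoc, inj_cofanProjection_of_ne hc hij.symm, zero_comp]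

theorem cofanIdempotent_comp [DecidableEq J] (hc : IsColimit c) {s t : Finset J} (h : s ≤ t) :
    cofanIdempotent hc s ≫ cofanIdempotent hc t = cofanIdempotent hc s := by
  rw [cofanIdempotent, Preadditive.sum_comp]
  refine Finset.sum_congr rfl fun j hj => ?_
  rw [Category.assoc, inj_cofanIdempotent hc (h hj)]

theorem cofanIdempotent_comp_cofanProjection [DecidableEq J] (hc : IsColimit c) {t : Finset J}
    {j : J} (hj : j ∉ t) : cofanIdempotent hc t ≫ cofanProjection hc j = 0 := by
  rw [cofanIdempotent, Preadditive.sum_comp]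
  refine Finset.sum_eq_zero fun i hi => ?_
  rw [Category.assoc, inj_cofanProjection_of_ne hc (ne_of_mem_of_not_mem hi hj), comp_zero]

/-- `Hom(E, -)` preserves a coproduct if every morphism from `E` to it factors through a finite
subsum. -/
theorem nonempty_isColimit_mapCocone_preadditiveCoyoneda [DecidableEq J] (hc : IsColimit c) {E : T}
    (hE : ∀ g : E ⟶ c.pt, ∃ t : Finset J, g ≫ cofanIdempotent hc t = g) :
    Nonempty (IsColimit ((preadditiveCoyoneda.obj (op E)).mapCocone c)) := by
  have hsupp : ∀ g : E ⟶ c.pt, ∃ t : Finset J,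
      g = ∑ j ∈ t, (g ≫ cofanProjection hc j) ≫ c.inj j ∧
        ∀ j ∉ t, g ≫ cofanProjection hc j = 0 := fun g => by
    obtain ⟨t, ht⟩ := hE g
    refine ⟨t, ?_, fun j hj => ?_⟩
    · conv_lhs => rw [← ht, cofanIdempotent, Preadditive.comp_sum]
      simp only [Category.assoc]
    · rw [← ht, Category.assoc, cofanIdempotent_comp_cofanProjection hc hj, comp_zero]
  let σ (s : Cocone (Discrete.functor X ⋙ preadditiveCoyoneda.obj (op E))) (j : J) :
      (E ⟶ X j) →+ s.pt := (s.ι.app ⟨j⟩).hom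
  have hfin (s : Cocone (Discrete.functor X ⋙ preadditiveCoyoneda.obj (op E))) (g : E ⟶ c.pt) :
      ∃ t : Finset J, (Function.support fun j => (σ s j (g ≫ cofanProjection hc j))) ⊆ t ∧
        g = ∑ j ∈ t, (g ≫ cofanProjection hc j) ≫ c.inj j := by
    obtain ⟨t, ht, ht'⟩ := hsupp g
    refine ⟨t, fun j hj => ?_, ht⟩
    by_contra hjt
    refine hj ?_
    simp only [ht' j hjt]
    exact map_zero _
  let desc (s : Cocone (Discrete.functor X ⋙ preadditiveCoyoneda.obj (op E))) :
      (E ⟶ c.pt) →+ s.pt :=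
    -- Each `g` has only finitely many nonzero components, so the sum is finite.
    { toFun := fun g => ∑ᶠ j, (σ s j (g ≫ cofanProjection hc j))
      map_zero' := by
        simp only [zero_comp]
        exact finsum_eq_zero_of_forall_eq_zero fun j => map_zero _
      map_add' := fun g h => by
        obtain ⟨t, ht, -⟩ := hfin s g
        obtain ⟨t', ht', -⟩ := hfin s h
        rw [← finsum_add_distrib (t.finite_toSet.subset ht) (t'.finite_toSet.subset ht')]
        refine finsum_congr fun j => ?_
        rw [Preadditive.add_comp]
        exact map_add _ _ _ }
  refine ⟨{ desc := fun s => AddCommGrpCat.ofHom (desc s), fac := ?_, uniq := ?_ }⟩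
  · rintro s ⟨k⟩
    ext (g : E ⟶ X k)
    change (∑ᶠ j, (σ s j ((g ≫ c.inj k) ≫ cofanProjection hc j))) = σ s k g
    rw [finsum_eq_single _ k fun j hj => ?_]
    · rw [Category.assoc, inj_cofanProjection_self, Category.comp_id]
    · rw [Category.assoc, inj_cofanProjection_of_ne hc hj.symm, comp_zero]
      exact map_zero _
  · intro s m hm
    ext (g : E ⟶ c.pt)
    change m.hom g = ∑ᶠ j, (σ s j (g ≫ cofanProjection hc j))
    have hm' : ∀ (j : J) (h : E ⟶ X j), m.hom (h ≫ c.inj j) = σ s j h := fun j h =>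
      congr_arg (fun a => a.hom h) (hm ⟨j⟩)
    obtain ⟨t, ht, hg⟩ := hfin s g
    rw [finsum_eq_sum_of_support_subset _ ht]
    conv_lhs => rw [hg]
    refine (map_sum m.hom _ _).trans (Finset.sum_congr rfl fun j _ => hm' j _)

end Compactness

/-! ### The compact generator -/

section BoundedSupported

open DerivedCategory Filter

variable {k : Type*} {A : Type u} [CommRing k] [CommRing A] [Algebra k A]
  [HasDerivedCategory.{w} (ModuleCat.{u} (diffOp k A)ᵐᵒᵖ)] {I : Ideal A}

theorem boundedSupportedOn_singleFunctor {M : ModuleCat.{u} (diffOp k A)ᵐᵒᵖ}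
    (h : IsSupportedOn I M) : boundedSupportedOn I ((singleFunctor _ 0).obj M) := by
  refine ⟨⟨⟨0, inferInstance⟩, ⟨0, inferInstance⟩⟩, fun n => ?_⟩
  rcases lt_trichotomy n 0 with hn | rfl | hn
  · exact .of_isZero (isZero_of_isGE _ 0 n hn)
  · exact h.of_iso ((singleFunctorCompHomologyFunctorIso _ 0).app M).symm
  · exact .of_isZero (isZero_of_isLE _ 0 n hn)

/-- An object of `D(D_V)` whose homology is generated by that of a family of uniformly bounded
complexes supported on `X` is itself such a complex. -/
theorem boundedSupportedOn_of_generated {J : Type*}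
    {S : DerivedCategory (ModuleCat.{u} (diffOp k A)ᵐᵒᵖ)}
    {X : J → DerivedCategory (ModuleCat.{u} (diffOp k A)ᵐᵒᵖ)}
    (i : ∀ j, X j ⟶ S) (π : ∀ j, S ⟶ X j)
    (hS : ∀ (n : ℤ) (y : (homologyFunctor (ModuleCat.{u} (diffOp k A)ᵐᵒᵖ) n).obj S),
      ∃ t : Finset J, (homologyFunctor _ n).map (∑ j ∈ t, π j ≫ i j) y = y)
    (a b : ℤ) (ha : ∀ j, (X j).IsGE a) (hb : ∀ j, (X j).IsLE b)
    (hX : ∀ j, cohomologySupportedOn I (X j)) : boundedSupportedOn I S := by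
  have hsum : ∀ (n : ℤ) (y : (homologyFunctor (ModuleCat.{u} (diffOp k A)ᵐᵒᵖ) n).obj S),
      ∃ t : Finset J, y = ∑ j ∈ t, (homologyFunctor _ n).map (i j)
        ((homologyFunctor _ n).map (π j) y) := fun n y => by
    obtain ⟨t, ht⟩ := hS n y
    refine ⟨t, ht.symm.trans ?_⟩
    rw [Functor.map_sum]
    change ModuleCat.Hom.hom _ y = _
    rw [ModuleCat.hom_sum, LinearMap.sum_apply]
    exact Finset.sum_congr rfl fun j _ => by rw [Functor.map_comp]; rfl
  have hzero : ∀ n : ℤ, (∀ j, IsZero ((homologyFunctor _ n).obj (X j))) →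
      IsZero ((homologyFunctor _ n).obj S) := fun n hn => by
    have : Subsingleton ((homologyFunctor (ModuleCat.{u} (diffOp k A)ᵐᵒᵖ) n).obj S) := by
      refine subsingleton_of_forall_eq 0 fun y => ?_
      obtain ⟨t, ht⟩ := hsum n y
      rw [ht]
      refine Finset.sum_eq_zero fun j _ => ?_
      have := ModuleCat.subsingleton_of_isZero (hn j)
      rw [Subsingleton.elim ((homologyFunctor _ n).map (π j) y) 0, map_zero]
    exact ModuleCat.isZero_of_subsingleton _
  refine ⟨⟨⟨a, (isGE_iff _ _).2 fun n hn => hzero n fun j => ?_⟩,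
    ⟨b, (isLE_iff _ _).2 fun n hn => hzero n fun j => ?_⟩⟩, fun n => ?_⟩
  · exact (isGE_iff _ _).1 (ha j) n hn
  · exact (isLE_iff _ _).1 (hb j) n hn
  · refine isSupportedOn_iff.2 fun y f hf => ?_
    obtain ⟨t, ht⟩ := hsum n y
    choose N hN using fun j => isSupportedOn_iff.1 (hX j n) ((homologyFunctor _ n).map (π j) y) f hf
    refine ⟨t.sup N, ?_⟩
    rw [ht, Finset.smul_sum]
    refine Finset.sum_eq_zero fun j hj => ?_
    rw [← map_smul, ← Nat.sub_add_cancel (Finset.le_sup (f := N) hj), pow_add, mul_smul, hN,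
      smul_zero, map_zero]

/-- Each term is a retract of the coproduct, so the bounds of the coproduct hold uniformly for all
terms. -/
theorem isZero_homology_of_isColimit_cofan [DecidableEq J] {X : J → BoundedDerivedSupportedOn k I}
    {c : Cofan X} (hc : IsColimit c) (j : J) (n : ℤ)
    (h : IsZero ((homologyFunctor _ n).obj c.pt.obj)) :
    IsZero ((homologyFunctor _ n).obj (X j).obj) := by
  have h₁ : (c.inj j).hom ≫ (cofanProjection hc j).hom = 𝟙 _ :=
    congr_arg (fun g => g.hom) (inj_cofanProjection_self hc j)
  rw [IsZero.iff_id_eq_zero, ← CategoryTheory.Functor.map_id, ← h₁, Functor.map_comp, h.eq_of_tgt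
    ((homologyFunctor _ n).map (c.inj j).hom) 0, zero_comp]

/-- Morphisms from a module with finite projective resolutions to a coproduct in `D^b_A(D_V)`
factor through a finite subsum. -/
theorem exists_comp_cofanIdempotent_eq {J : Type u} [DecidableEq J]
    {X : J → BoundedDerivedSupportedOn k I} {c : Cofan X} (hc : IsColimit c)
    {M : ModuleCat.{u} (diffOp k A)ᵐᵒᵖ} (hM : ∀ n, HasFiniteProjectiveResolution n M)
    (h : boundedSupportedOn I ((singleFunctor _ 0).obj M))
    (g : (⟨_, h⟩ : BoundedDerivedSupportedOn k I) ⟶ c.pt) :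
    ∃ t : Finset J, g ≫ cofanIdempotent hc t = g := by
  obtain ⟨⟨⟨a, ha⟩, ⟨b, hb⟩⟩, -⟩ := c.pt.property
  obtain ⟨S, i, π, ψ, hψ, hS⟩ := exists_coproduct_factorization fun j => (c.inj j).hom
  have hSb : boundedSupportedOn I S := boundedSupportedOn_of_generated i π hS a b
    (fun j => (isGE_iff _ _).2 fun n hn =>
      isZero_homology_of_isColimit_cofan hc j n ((isGE_iff _ _).1 ha n hn))
    (fun j => (isLE_iff _ _).2 fun n hn =>
      isZero_homology_of_isColimit_cofan hc j n ((isLE_iff _ _).1 hb n hn))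
    fun j => (X j).property.2
  let S' : BoundedDerivedSupportedOn k I := ⟨S, hSb⟩
  -- The universal property of `c` is available only against objects of the subcategory, which is
  -- why `hSb` is needed.
  let φ : c.pt ⟶ S' := Cofan.IsColimit.desc hc fun j => ObjectProperty.homMk (i j)
  have hφ : φ.hom ≫ ψ = 𝟙 c.pt.obj := by
    have : φ ≫ ObjectProperty.homMk ψ = 𝟙 c.pt := by
      refine Cofan.IsColimit.hom_ext hc _ _ fun j => ?_
      rw [← Category.assoc, Cofan.IsColimit.fac, Category.comp_id]
      exact ObjectProperty.hom_ext _ (hψ j)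
    exact congr_arg (fun g => g.hom) this
  have hH : ∀ (n : ℤ) (x : (homologyFunctor (ModuleCat.{u} (diffOp k A)ᵐᵒᵖ) n).obj c.pt.obj),
      ∀ᶠ t in atTop, (homologyFunctor _ n).map (cofanIdempotent hc t).hom x = x := by
    intro n x
    obtain ⟨t, ht⟩ := hS n ((homologyFunctor _ n).map φ.hom x)
    let ε : c.pt.obj ⟶ c.pt.obj := φ.hom ≫ (∑ j ∈ t, π j ≫ i j) ≫ ψ
    have hx : (homologyFunctor _ n).map ε x = x := by
      have h₁ : (homologyFunctor _ n).map ε x = (homologyFunctor _ n).map ψ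
          ((homologyFunctor _ n).map (∑ j ∈ t, π j ≫ i j) ((homologyFunctor _ n).map φ.hom x)) := by
        simp only [ε, Functor.map_comp]
        rfl
      have h₂ : (homologyFunctor _ n).map ψ ((homologyFunctor _ n).map φ.hom x) = x := by
        have := congr_arg (fun g : c.pt.obj ⟶ c.pt.obj =>
          ((homologyFunctor (ModuleCat.{u} (diffOp k A)ᵐᵒᵖ) n).map g).hom x) hφ
        simpa using this
      rw [h₁, ht, h₂]
    filter_upwards [eventually_ge_atTop t] with t' htt'
    have hε : ε ≫ (cofanIdempotent hc t').hom = ε := by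
      simp only [ε, Category.assoc, Preadditive.sum_comp]
      congr 1
      refine Finset.sum_congr rfl fun j hj => ?_
      rw [← Category.assoc (i j), hψ]
      congr 1
      exact congr_arg (fun g => g.hom) (inj_cofanIdempotent hc (htt' hj))
    rw [← hx]
    have := congr_arg (fun g : c.pt.obj ⟶ c.pt.obj =>
          ((homologyFunctor (ModuleCat.{u} (diffOp k A)ᵐᵒᵖ) n).map g).hom x) hε
    simpa using this
  -- A resolution of length `1 - a` (none if `a > 0`) suffices for `D_X` in degree `0`.
  have hlt : (0 : ℤ) < a + ((1 - a).toNat : ℤ) := by omega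
  obtain ⟨t, ht⟩ := (eventually_comp_eq (e := fun t => (cofanIdempotent hc t).hom)
    (fun s t hst => congr_arg (fun g => g.hom) (cofanIdempotent_comp hc hst)) hH a _ M
    (hM _) 0 hlt g.hom).exists
  exact ⟨t, ObjectProperty.hom_ext _ ht⟩

theorem isCompactObject_singleFunctor {M : ModuleCat.{u} (diffOp k A)ᵐᵒᵖ}
    (hM : ∀ n, HasFiniteProjectiveResolution n M)
    (h : boundedSupportedOn I ((singleFunctor _ 0).obj M)) :
    IsCompactObject.{u} (⟨_, h⟩ : BoundedDerivedSupportedOn k I) := by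
  classical
  intro J
  have : ∀ X : J → BoundedDerivedSupportedOn k I, PreservesColimit (Discrete.functor X)
      (preadditiveCoyoneda.obj (op (⟨_, h⟩ : BoundedDerivedSupportedOn k I))) := fun X =>
    ⟨fun {c} hc => nonempty_isColimit_mapCocone_preadditiveCoyoneda (c := c) hc
      (exists_comp_cofanIdempotent_eq hc hM h)⟩
  exact preservesColimitsOfShape_of_discrete _

theorem isGeneratorObject_canonicalDModule [IsNoetherianRing A]
    (h : boundedSupportedOn I ((singleFunctor _ 0).obj (canonicalDModule k I))) :
    IsGeneratorObject (⟨_, h⟩ : BoundedDerivedSupportedOn k I) := by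
  intro C hC
  obtain ⟨⟨⟨a, ha⟩, ⟨b, hb⟩⟩, hs⟩ := C.property
  have hom_eq_zero : ∀ (n : ℤ) (f : (singleFunctor _ n).obj (canonicalDModule k I) ⟶ C.obj),
      f = 0 := fun n f => by
    -- The shift by `-n` moves degree `0` to degree `n`.
    let e := ((boundedSupportedOn (k := k) I).ι.commShiftIso (-n)).app
      (⟨_, h⟩ : BoundedDerivedSupportedOn k I) ≪≫
      ((singleFunctors _).shiftIso (-n) n 0 (by omega)).app (canonicalDModule k I)
    have h0 := hC (-n) (ObjectProperty.homMk (e.hom ≫ f))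
    have h1 : e.hom ≫ f = 0 := congr_arg (fun g => g.hom) h0
    rw [← cancel_epi e.hom, h1, comp_zero]
  -- The lower bound rises one degree at a time, since a nonzero lowest cohomology module would
  -- receive a map from `D_X`; past `b` the object is zero.
  have hGE : ∀ m : ℕ, C.obj.IsGE (a + m) := fun m => by
    induction m with
    | zero => simpa using ha
    | succ m ih =>
      refine (isGE_iff _ _).2 fun n hn => ?_
      rcases lt_or_eq_of_le (show n ≤ a + m by push_cast at hn; omega) with hlt | rfl
      · exact isZero_of_isGE _ _ n hlt
      · by_contra hz
        have : Nontrivial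
            ((homologyFunctor (ModuleCat.{u} (diffOp k A)ᵐᵒᵖ) (a + m)).obj C.obj) := by
          rw [← not_subsingleton_iff_nontrivial]
          exact fun _ => hz (ModuleCat.isZero_of_subsingleton _)
        obtain ⟨x, hx, hIx⟩ := (hs (a + m)).exists_killed this
        obtain ⟨φ, hφ⟩ := exists_canonicalDModule_hom hIx hx
        obtain ⟨f, hf⟩ := exists_singleFunctor_hom_ne_zero φ hφ
        exact hf (hom_eq_zero _ f)
  have := hGE (b + 1 - a).toNat
  have hz : IsZero C.obj := TStructure.t.isZero C.obj b (a + (b + 1 - a).toNat) (by omega)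
  rw [IsZero.iff_id_eq_zero]
  exact ObjectProperty.hom_ext _ (hz.eq_of_src _ _)

end BoundedSupported

theorem theorem2p2 (A : Type u) [CommRing A] [Algebra ℂ A] [Algebra.Smooth ℂ A]
    (I : Ideal A) (hI : I.IsRadical)
    [HasDerivedCategory.{w} (ModuleCat.{u} (diffOp ℂ A)ᵐᵒᵖ)] :
    ∃ h : boundedSupportedOn I
        ((DerivedCategory.singleFunctor _ 0).obj (canonicalDModule ℂ I)),
      IsCompactObject.{u} (⟨_, h⟩ : BoundedDerivedSupportedOn ℂ I) ∧
      IsGeneratorObject (⟨_, h⟩ : BoundedDerivedSupportedOn ℂ I) := by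
  have : IsNoetherianRing A := Algebra.FiniteType.isNoetherianRing ℂ A
  have h := boundedSupportedOn_singleFunctor (isSupportedOn_canonicalDModule (k := ℂ) I)
  exact ⟨h, isCompactObject_singleFunctor
    (hasFiniteProjectiveResolution_canonicalDModule I) h, isGeneratorObject_canonicalDModule h⟩
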